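/- Let $\alpha\in\mathbb{C}\setminus\{0\}$, let $l\ge 1$ be an integer, and consider the Hamiltonian $H=\tfrac12(p_1^2+p_2^2)+\alpha(q_1^2+q_2^2)^l$ on $\mathbb{C}^4$, with Hamiltonian system $$\dot q_1=p_1,\quad \dot q_2=p_2,\quad \dot p_1=-2l\alpha\, q_1(q_1^2+q_2^2)^{l-1},\quad \dot p_2=-2l\alpha\, q_2(q_1^2+q_2^2)^{l-1}.$$ Let $(\lambda_1,\lambda_2)\in\mathbb{C}^2\setminus\{(0,0)\}$ and let $\Gamma=\{(q_1,q_2,p_1,p_2)\in\mathbb{C}^4:\ \lambda_1q_1+\lambda_2q_2=\lambda_1p_1+\lambda_2p_2=0\}$. Let $\gamma:D\to\Gamma$ be a holomorphic solution of the system, defined on a nonempty connected open set $D\subseteq\mathbb{C}$ of times $t$, contained in $\Gamma$ and with zero energy, $H(\gamma(t))=0$ for all $t\in D$. Then the coefficient matrix $A(t)=X_H'(\gamma(t))$ of the first variational equation $\dot\xi=A(t)\xi$ along $\gamma$ (where $X_H'$ is the Jacobian matrix of the Hamiltonian vector field $X_H$) is the restriction to $D$ of a matrix of rational functions of $t$ without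 poles in $D$, and the identity component of the differential Galois group of $\dot\xi=A(t)\xi$ over the differential field $(\mathbb{C}(t),d/dt)$ is a subgroup of the diagonal group in a suitable basis of solutions. That is, for every Picard-Vessiot extension $L$ of $\mathbb{C}(t)$ for this equation there is a fundamental matrix $U\in\mathrm{GL}_4(L)$ such that, in the representation $\sigma\mapsto U^{-1}\sigma(U)\in \mathrm{GL}_4(\mathbb{C})$ of the group of differential automorphisms of $L$ over $\mathbb{C}(t)$, the connected component of the identity in the Zariski topology is mapped to diagonal matrices. -/

import Mathlib

noncomputable section

set_option linter.unusedSectionVars false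

namespace VariationalGalois

/-! ### The differential field of rational functions -/

/-- The differential ring given by an additive map that satisfies the Leibniz rule. -/
@[reducible]
def differentialOf {R : Type*} [CommRing R] (d : R → R) (hadd : ∀ a b, d (a + b) = d a + d b)
    (hmul : ∀ a b, d (a * b) = a * d b + b * d a) : Differential R where
  deriv := Derivation.mk' (AddMonoidHom.toIntLinearMap (AddMonoidHom.mk' d hadd)) hmul

section RationalFunctions

variable (F : Type*) [Field F]

/-- The derivative `d/dt` of a rational function, by the quotient rule. -/
def ratDeriv (f : RatFunc F) : RatFunc F :=
  algebraMap (Polynomial F) (RatFunc F)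
      (Polynomial.derivative f.num * f.denom - f.num * Polynomial.derivative f.denom) /
    algebraMap (Polynomial F) (RatFunc F) f.denom ^ 2

lemma ratDeriv_div (p q : Polynomial F) (hq : q ≠ 0) :
    ratDeriv F (algebraMap _ (RatFunc F) p / algebraMap _ (RatFunc F) q) =
      algebraMap _ (RatFunc F)
        (Polynomial.derivative p * q - p * Polynomial.derivative q) /
        algebraMap _ (RatFunc F) q ^ 2 := by
  set f : RatFunc F := algebraMap _ (RatFunc F) p / algebraMap _ (RatFunc F) q with hf
  have hd : f.denom ≠ 0 := f.denom_ne_zero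
  have hq' : algebraMap (Polynomial F) (RatFunc F) q ≠ 0 := RatFunc.algebraMap_ne_zero hq
  have hd' : algebraMap (Polynomial F) (RatFunc F) f.denom ≠ 0 :=
    RatFunc.algebraMap_ne_zero hd
  have h1 : f.num * q = p * f.denom := by
    apply RatFunc.algebraMap_injective F
    rw [map_mul, map_mul]
    have h2 : algebraMap _ (RatFunc F) f.num / algebraMap _ (RatFunc F) f.denom =
        algebraMap _ (RatFunc F) p / algebraMap _ (RatFunc F) q := by
      rw [RatFunc.num_div_denom f]
    rwa [div_eq_div_iff hd' hq'] at h2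
  have h3 : Polynomial.derivative f.num * q + f.num * Polynomial.derivative q =
      Polynomial.derivative p * f.denom + p * Polynomial.derivative f.denom := by
    have := congrArg Polynomial.derivative h1
    simpa [Polynomial.derivative_mul] using this
  rw [ratDeriv, div_eq_div_iff (pow_ne_zero 2 hd') (pow_ne_zero 2 hq'), ← map_pow, ← map_pow,
    ← map_mul, ← map_mul]
  congr 1
  linear_combination (f.denom * q) * h3 -
    (Polynomial.derivative f.denom * q + f.denom * Polynomial.derivative q) * h1

/-- The field of rational functions `F(t)` is a differential field with derivation `d/dt`. -/
instance ratFuncDifferential : Differential (RatFunc F) :=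
  differentialOf (ratDeriv F)
    (by
      intro a b
      induction a using RatFunc.induction_on with
      | f p q hq =>
      induction b using RatFunc.induction_on with
      | f r s hs =>
      have hq' : algebraMap (Polynomial F) (RatFunc F) q ≠ 0 := RatFunc.algebraMap_ne_zero hq
      have hs' : algebraMap (Polynomial F) (RatFunc F) s ≠ 0 := RatFunc.algebraMap_ne_zero hs
      rw [div_add_div _ _ hq' hs', ← map_mul, ← map_mul, ← map_mul, ← map_add,
        ratDeriv_div F _ _ (mul_ne_zero hq hs), ratDeriv_div F _ _ hq, ratDeriv_div F _ _ hs]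
      simp only [Polynomial.derivative_mul, map_add, map_mul, map_sub]
      field_simp
      ring)
    (by
      intro a b
      induction a using RatFunc.induction_on with
      | f p q hq =>
      induction b using RatFunc.induction_on with
      | f r s hs =>
      have hq' : algebraMap (Polynomial F) (RatFunc F) q ≠ 0 := RatFunc.algebraMap_ne_zero hq
      have hs' : algebraMap (Polynomial F) (RatFunc F) s ≠ 0 := RatFunc.algebraMap_ne_zero hs
      rw [div_mul_div_comm, ← map_mul, ← map_mul,
        ratDeriv_div F _ _ (mul_ne_zero hq hs), ratDeriv_div F _ _ hq, ratDeriv_div F _ _ hs]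
      simp only [Polynomial.derivative_mul, map_add, map_mul, map_sub]
      field_simp
      ring)

lemma deriv_ratFunc (f : RatFunc F) : Differential.deriv f = ratDeriv F f := rfl

end RationalFunctions

/-! ### Linear differential systems, Picard-Vessiot extensions, differential Galois groups -/

section DifferentialGalois

variable (K : Type*) [Field K] [Differential K]

/-- The field of constants of a differential field. -/
def constants : Subfield K where
  carrier := {c | Differential.deriv c = 0}
  zero_mem' := by simp
  one_mem' := by simp
  add_mem' := by
    intro a b ha hb
    simp only [Set.mem_ofPred_eq] at ha hb ⊢
    rw [map_add, ha, hb, add_zero]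
  mul_mem' := by
    intro a b ha hb
    simp only [Set.mem_ofPred_eq] at ha hb ⊢
    rw [Derivation.leibniz, ha, hb, smul_zero, smul_zero, add_zero]
  neg_mem' := by
    intro a ha
    simp only [Set.mem_ofPred_eq] at ha ⊢
    rw [map_neg, ha, neg_zero]
  inv_mem' := by
    intro a ha
    simp only [Set.mem_ofPred_eq] at ha ⊢
    rw [Derivation.leibniz_inv, ha, smul_zero]

variable {K}
variable {n : Type*} [Fintype n] [DecidableEq n]
variable (L : Type*) [Field L] [Differential L] [Algebra K L]

/-- `U` is a fundamental matrix with entries in `L` of the system `Y' = A Y` over `K`. -/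
def IsFundamentalMatrix (A : Matrix n n K) (U : Matrix.GeneralLinearGroup n L) : Prop :=
  ∀ i j, Differential.deriv (U i j) = ∑ k, algebraMap K L (A i k) * U k j

/-- The differential field extension `L / K` is a Picard-Vessiot extension for `Y' = A Y`:
it has no new constants and it is generated over `K` by the entries of a fundamental matrix
(the field generated by these entries is closed under the derivation). -/
structure IsPicardVessiot (A : Matrix n n K) : Prop where
  deriv_algebraMap : ∀ a : K,
    Differential.deriv (algebraMap K L a) = algebraMap K L (Differential.deriv a)
  constants_le : ∀ x : L, Differential.deriv x = 0 → ∃ c : K, algebraMap K L c = x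
  generated : ∃ U : Matrix.GeneralLinearGroup n L, IsFundamentalMatrix L A U ∧
    IntermediateField.adjoin K {x : L | ∃ i j, x = U i j} = ⊤

variable (K)

/-- The differential Galois group of `L / K`: the field automorphisms of `L` that fix `K`
pointwise and commute with the derivation. -/
def differentialGaloisGroup : Subgroup (L ≃ₐ[K] L) where
  carrier := {σ | ∀ x : L, Differential.deriv (σ x) = σ (Differential.deriv x)}
  one_mem' := fun _ => rfl
  mul_mem' := by
    intro σ τ hσ hτ x
    rw [AlgEquiv.mul_apply, hσ, hτ, AlgEquiv.mul_apply]
  inv_mem' := by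
    intro σ hσ x
    apply σ.injective
    rw [← hσ]
    change Differential.deriv (σ (σ.symm x)) = σ (σ.symm (Differential.deriv x))
    rw [AlgEquiv.apply_symm_apply, AlgEquiv.apply_symm_apply]

variable {K L}

/-- The action of an automorphism on invertible matrices, entry by entry. -/
def galoisMap (σ : L ≃ₐ[K] L) : Matrix.GeneralLinearGroup n L →* Matrix.GeneralLinearGroup n L :=
  Matrix.GeneralLinearGroup.map (σ : L →+* L)

lemma galoisMap_apply (σ : L ≃ₐ[K] L) (U : Matrix.GeneralLinearGroup n L) (i j : n) :
    galoisMap σ U i j = σ (U i j) := rfl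

/-- The inclusion of the constants of `K` into `L`. -/
def constantsToExt : constants K →+* L := (algebraMap K L).comp (constants K).subtype

lemma galoisMap_isFundamentalMatrix {A : Matrix n n K} {U : Matrix.GeneralLinearGroup n L}
    (hU : IsFundamentalMatrix L A U) (σ : differentialGaloisGroup K L) :
    IsFundamentalMatrix L A (galoisMap (σ : L ≃ₐ[K] L) U) := by
  intro i j
  rw [galoisMap_apply, σ.2, hU i j, map_sum]
  simp [galoisMap_apply]

lemma deriv_matrix_mul (P Q : Matrix n n L) (i j : n) :
    Differential.deriv ((P * Q) i j) =
      ((P.map Differential.deriv) * Q + P * (Q.map Differential.deriv)) i j := by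
  simp only [Matrix.mul_apply, Matrix.add_apply, Matrix.map_apply, map_sum,
    Derivation.leibniz, smul_eq_mul, Finset.sum_add_distrib]
  rw [add_comm]
  congr 1
  exact Finset.sum_congr rfl fun k _ => mul_comm _ _

/-- Two fundamental matrices differ by a matrix of constants. -/
lemma deriv_inv_mul_eq_zero {A : Matrix n n K} {U W : Matrix.GeneralLinearGroup n L}
    (hU : IsFundamentalMatrix L A U) (hW : IsFundamentalMatrix L A W) (i j : n) :
    Differential.deriv ((U⁻¹ * W) i j) = 0 := by
  have hU' : (U : Matrix n n L).map Differential.deriv = A.map (algebraMap K L) * U := by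
    ext i j
    simpa [Matrix.mul_apply] using hU i j
  have hW' : (W : Matrix n n L).map Differential.deriv = A.map (algebraMap K L) * W := by
    ext i j
    simpa [Matrix.mul_apply] using hW i j
  set C : Matrix n n L := ((U⁻¹ * W : Matrix.GeneralLinearGroup n L) : Matrix n n L) with hC
  have hUC : (U : Matrix n n L) * C = W := by
    rw [hC, ← Units.val_mul, mul_inv_cancel_left]
  have h : (U : Matrix n n L) * C.map Differential.deriv = 0 := by
    have h1 : (W : Matrix n n L).map Differential.deriv =
        (U : Matrix n n L).map Differential.deriv * C + U * C.map Differential.deriv := by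
      ext i j
      rw [← hUC, Matrix.map_apply, deriv_matrix_mul]
    rw [hW', hU', mul_assoc, hUC] at h1
    simpa using h1
  have h2 : C.map Differential.deriv = 0 := by
    have := congrArg (fun M => ((U⁻¹ : Matrix.GeneralLinearGroup n L) : Matrix n n L) * M) h
    simpa only [← mul_assoc, ← Units.val_mul, inv_mul_cancel, Units.val_one, one_mul,
      mul_zero] using this
  exact congrFun (congrFun h2 i) j

lemma constantsToExt_injective : Function.Injective (constantsToExt : constants K →+* L) :=
  RingHom.injective (constantsToExt : constants K →+* L)

lemma exists_constant {A : Matrix n n K} (hL : IsPicardVessiot L A) {x : L}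
    (hx : Differential.deriv x = 0) : ∃ c : constants K, constantsToExt c = x := by
  obtain ⟨c, hc⟩ := hL.constants_le x hx
  refine ⟨⟨c, ?_⟩, hc⟩
  change Differential.deriv c = 0
  apply (algebraMap K L).injective
  rw [← hL.deriv_algebraMap, hc, hx, map_zero]

lemma exists_constant_matrix {A : Matrix n n K} (hL : IsPicardVessiot L A)
    {V : Matrix.GeneralLinearGroup n L} (hV : ∀ i j, Differential.deriv (V i j) = 0) :
    ∃ M : Matrix.GeneralLinearGroup n (constants K),
      Matrix.GeneralLinearGroup.map constantsToExt M = V := by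
  choose M hM using fun i j => exists_constant hL (hV i j)
  have hMV : (Matrix.of M).map (constantsToExt : constants K →+* L) = V := by
    ext i j
    exact hM i j
  have hdet : (Matrix.of M).det ≠ 0 := by
    intro h0
    have h1 := RingHom.map_det (constantsToExt : constants K →+* L) (Matrix.of M)
    rw [h0, map_zero, RingHom.mapMatrix_apply, hMV] at h1
    exact (Matrix.GeneralLinearGroup.det V).ne_zero h1.symm
  refine ⟨Matrix.GeneralLinearGroup.mkOfDetNeZero (Matrix.of M) hdet, ?_⟩
  apply Units.ext
  exact hMV

lemma exists_galois_matrix {A : Matrix n n K} (hL : IsPicardVessiot L A)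
    {U : Matrix.GeneralLinearGroup n L} (hU : IsFundamentalMatrix L A U)
    (σ : differentialGaloisGroup K L) :
    ∃ M : Matrix.GeneralLinearGroup n (constants K),
      Matrix.GeneralLinearGroup.map constantsToExt M =
        U⁻¹ * galoisMap (σ : L ≃ₐ[K] L) U :=
  exists_constant_matrix hL
    (deriv_inv_mul_eq_zero hU (galoisMap_isFundamentalMatrix hU σ))

lemma map_constantsToExt_injective :
    Function.Injective (Matrix.GeneralLinearGroup.map (n := n)
      (constantsToExt : constants K →+* L)) := by
  intro M N h
  ext i j
  have h1 : constantsToExt (L := L) (M i j) = constantsToExt (N i j) :=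
    congrArg (fun V : Matrix.GeneralLinearGroup n L => V i j) h
  exact congrArg Subtype.val (constantsToExt_injective h1)

/-- The matrix of constants `M = U⁻¹ σ(U)`, that is `σ(U) = U M`. -/
def galoisMatrix {A : Matrix n n K} (hL : IsPicardVessiot L A)
    {U : Matrix.GeneralLinearGroup n L} (hU : IsFundamentalMatrix L A U)
    (σ : differentialGaloisGroup K L) : Matrix.GeneralLinearGroup n (constants K) :=
  (exists_galois_matrix hL hU σ).choose

lemma map_galoisMatrix {A : Matrix n n K} (hL : IsPicardVessiot L A)
    {U : Matrix.GeneralLinearGroup n L} (hU : IsFundamentalMatrix L A U)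
    (σ : differentialGaloisGroup K L) :
    Matrix.GeneralLinearGroup.map constantsToExt (galoisMatrix hL hU σ) =
      U⁻¹ * galoisMap (σ : L ≃ₐ[K] L) U :=
  (exists_galois_matrix hL hU σ).choose_spec

lemma galoisMap_constants (σ : L ≃ₐ[K] L) (M : Matrix.GeneralLinearGroup n (constants K)) :
    galoisMap σ (Matrix.GeneralLinearGroup.map (constantsToExt : constants K →+* L) M) =
      Matrix.GeneralLinearGroup.map constantsToExt M := by
  ext i j
  exact σ.commutes _

/-- The faithful representation `σ ↦ U⁻¹ σ(U)` of the differential Galois group of a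
Picard-Vessiot extension on `GL_n` of the field of constants, given by a fundamental matrix. -/
def galoisRep {A : Matrix n n K} (hL : IsPicardVessiot L A)
    {U : Matrix.GeneralLinearGroup n L} (hU : IsFundamentalMatrix L A U) :
    differentialGaloisGroup K L →* Matrix.GeneralLinearGroup n (constants K) :=
  MonoidHom.mk' (galoisMatrix hL hU) (by
    intro σ τ
    apply map_constantsToExt_injective (L := L)
    have hτ : galoisMap (τ : L ≃ₐ[K] L) U =
        U * Matrix.GeneralLinearGroup.map constantsToExt (galoisMatrix hL hU τ) := by
      rw [map_galoisMatrix, mul_inv_cancel_left]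
    have hστ : galoisMap ((σ * τ : differentialGaloisGroup K L) : L ≃ₐ[K] L) U =
        galoisMap (σ : L ≃ₐ[K] L) (galoisMap (τ : L ≃ₐ[K] L) U) := by
      ext i j
      rfl
    rw [map_mul, map_galoisMatrix hL hU (σ * τ), hστ, hτ, map_mul, galoisMap_constants, map_galoisMatrix hL hU σ,
      mul_assoc])

end DifferentialGalois

/-! ### Zariski topology, identity component, diagonal group -/

section Zariski

variable {n : Type*} [Fintype n] [DecidableEq n] {F : Type*} [Field F]

/-- The Zariski topology on the affine space of square matrices: it is generated by the sets
on which a polynomial in the entries does not vanish. -/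
@[reducible]
def zariskiTopology (n F : Type*) [Field F] : TopologicalSpace (Matrix n n F) :=
  TopologicalSpace.generateFrom
    {S | ∃ p : MvPolynomial (n × n) F,
      S = {M | MvPolynomial.eval (fun ij : n × n => M ij.1 ij.2) p ≠ 0}}

/-- The topology on a group `G` induced from the Zariski topology by a representation. -/
@[reducible]
def groupZariskiTopology {G : Type*} [Group G] (ρ : G →* Matrix.GeneralLinearGroup n F) :
    TopologicalSpace G :=
  TopologicalSpace.induced (fun g => (ρ g : Matrix n n F)) (zariskiTopology n F)

lemma continuous_mul_left_zariski {G : Type*} [Group G]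
    (ρ : G →* Matrix.GeneralLinearGroup n F) (a : G) :
    @Continuous G G (groupZariskiTopology ρ) (groupZariskiTopology ρ) (fun g => a * g) := by
  let _ := zariskiTopology n F
  let _ := groupZariskiTopology ρ
  have h1 : Continuous (fun g : G => (ρ g : Matrix n n F)) := continuous_induced_dom
  have h2 : Continuous (fun M : Matrix n n F => (ρ a : Matrix n n F) * M) := by
    refine continuous_generateFrom_iff.2 ?_
    rintro S ⟨p, rfl⟩
    refine TopologicalSpace.isOpen_generateFrom_of_mem
      ⟨MvPolynomial.bind₁ (fun ij : n × n =>
        ∑ k, MvPolynomial.C ((ρ a : Matrix n n F) ij.1 k) * MvPolynomial.X (k, ij.2)) p, ?_⟩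
    ext M
    have : MvPolynomial.eval (fun ij : n × n => M ij.1 ij.2)
        (MvPolynomial.bind₁ (fun ij : n × n =>
          ∑ k, MvPolynomial.C ((ρ a : Matrix n n F) ij.1 k) * MvPolynomial.X (k, ij.2)) p) =
        MvPolynomial.eval
          (fun ij : n × n => ((ρ a : Matrix n n F) * M) ij.1 ij.2) p := by
      rw [MvPolynomial.eval, MvPolynomial.eval₂Hom_bind₁]
      congr 2
      ext ij
      simp [Matrix.mul_apply]
    simp only [Set.mem_preimage, Set.mem_ofPred_eq, this]
  refine continuous_induced_rng.2 ?_
  have h3 : (fun g : G => (ρ g : Matrix n n F)) ∘ (fun g => a * g) =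
      (fun M : Matrix n n F => (ρ a : Matrix n n F) * M) ∘ fun g => (ρ g : Matrix n n F) := by
    ext g
    simp
  rw [h3]
  exact h2.comp h1

/-- The identity component of a linear group `G` with representation `ρ`: the connected
component of the identity in the Zariski topology. -/
def identityComponent {G : Type*} [Group G] (ρ : G →* Matrix.GeneralLinearGroup n F) :
    Subgroup G where
  carrier := @connectedComponent G (groupZariskiTopology ρ) 1
  one_mem' := @mem_connectedComponent G (groupZariskiTopology ρ) 1
  mul_mem' := by
    let _ := groupZariskiTopology ρ
    intro a b ha hb
    have h := Continuous.image_connectedComponent_subset (continuous_mul_left_zariski ρ a) 1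
    have h1 : a * b ∈ connectedComponent (a * 1) := h ⟨b, hb, rfl⟩
    rw [mul_one] at h1
    have h2 : connectedComponent a = connectedComponent 1 := (connectedComponent_eq ha).symm
    exact h2 ▸ h1
  inv_mem' := by
    let _ := groupZariskiTopology ρ
    intro a ha
    have h := Continuous.image_connectedComponent_subset (continuous_mul_left_zariski ρ a⁻¹) 1
    have h1 : a⁻¹ * a ∈ connectedComponent (a⁻¹ * 1) := h ⟨a, ha, rfl⟩
    rw [mul_one, inv_mul_cancel] at h1
    have h2 := connectedComponent_eq h1
    change a⁻¹ ∈ connectedComponent 1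
    rw [← h2]
    exact mem_connectedComponent

variable (n F)

/-- The group of invertible diagonal matrices. -/
def diagonalGroup : Subgroup (Matrix.GeneralLinearGroup n F) :=
  (Units.map (Matrix.diagonalRingHom n F : (n → F) →* Matrix n n F)).range

end Zariski

/-! ### The Hamiltonian system; coordinates `0, 1, 2, 3` stand for `q₁, q₂, p₁, p₂` -/

section Hamiltonian

open MvPolynomial

/-- `H = (p₁² + p₂²) / 2 + α (q₁² + q₂²) ^ l`. -/
def hamiltonian (α : ℂ) (l : ℕ) : MvPolynomial (Fin 4) ℂ :=
  C (1 / 2) * (X 2 ^ 2 + X 3 ^ 2) + C α * (X 0 ^ 2 + X 1 ^ 2) ^ l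

/-- The Hamiltonian vector field `X_H = J ∇H`. -/
def hamiltonianField (H : MvPolynomial (Fin 4) ℂ) : Fin 4 → MvPolynomial (Fin 4) ℂ :=
  ![pderiv 2 H, pderiv 3 H, -pderiv 0 H, -pderiv 1 H]

/-- `γ` is an integral curve of `X_H` on the domain `D` of complex time. -/
def IsIntegralCurve (H : MvPolynomial (Fin 4) ℂ) (D : Set ℂ) (γ : ℂ → Fin 4 → ℂ) : Prop :=
  ∀ t ∈ D, ∀ i, HasDerivAt (fun s => γ s i) (eval (γ t) (hamiltonianField H i)) t

/-- The plane `λ₁ q₁ + λ₂ q₂ = λ₁ p₁ + λ₂ p₂ = 0`. -/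
def invariantPlane (a b : ℂ) : Set (Fin 4 → ℂ) :=
  {z | a * z 0 + b * z 1 = 0 ∧ a * z 2 + b * z 3 = 0}

/-- The Jacobian matrix of `X_H` at the point `z`. Along an integral curve `γ`, the first
variational equation is `ξ' = variationalMatrix H (γ t) ξ`. -/
def variationalMatrix (H : MvPolynomial (Fin 4) ℂ) (z : Fin 4 → ℂ) : Matrix (Fin 4) (Fin 4) ℂ :=
  Matrix.of fun i j => eval z (pderiv j (hamiltonianField H i))

/-- On `D`, the matrix function `A` is given by a matrix `B` of rational functions without
poles in `D`. -/
def IsRationalOn (D : Set ℂ) (A : ℂ → Matrix (Fin 4) (Fin 4) ℂ)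
    (B : Matrix (Fin 4) (Fin 4) (RatFunc ℂ)) : Prop :=
  ∀ t ∈ D, ∀ i j, (B i j).denom.eval t ≠ 0 ∧ (B i j).eval (RingHom.id ℂ) t = A t i j

end Hamiltonian

end VariationalGalois

end

noncomputable section

namespace VariationalGalois

/-! ### Systems that become diagonal over the base field -/

section Gauge

variable {K : Type*} [Field K] [Differential K] {n : Type*} [Fintype n] [DecidableEq n]

/-! The variational equation can be solved explicitly enough that the whole differential Galois
group, not only its identity component, is diagonal. If a gauge matrix `P` over `ℂ(t)` turns `Y' = B
Y` into `Y' = diag(a) Y`, solutions are the columns of `P` times scalars `w_j` with `w_j' = a_j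
w_j`, and each automorphism only rescales the `w_j`
(`exists_fundamentalMatrix_range_le_diagonalGroup`).

The equation reads `ξ'' = S(t) ξ`, with `S` minus the Hessian of the potential along `γ`. Put `R =
q₁² + q₂²`.

For `l = 1`, `S = -2α` is scalar and the solutions are exponentials.

For `l ≥ 2` and `λ₁² + λ₂² ≠ 0`, `S` has constant eigenvectors, `(λ₁, λ₂)` and `(-λ₂, λ₁)`. With `u`
the coordinate of `q` along the second, zero energy reads `u'² = C u^(2l)`. So either `u = 0`
identically or `u^(-(l-1))` is affine in `t`. Both eigenvalues are then zero or a constant times `(t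
- t₀)⁻²`, and the equation splits into two Euler equations (`eq_zero_or_pow_eq_of_energy`,
`hasDiagonalGauge_of_riccati`).

For `l ≥ 2` and `λ₁² + λ₂² = 0`, `R` vanishes on the plane, the motion is free, and `S = β v vᵀ`
with `v` isotropic and `β` polynomial. There is then a polynomial fundamental matrix
(`hasDiagonalGauge_isotropic`). -/

lemma mem_diagonalGroup {F : Type*} [Field F] (M : Matrix.GeneralLinearGroup n F)
    (h : ∀ i j, i ≠ j → M i j = 0) : M ∈ diagonalGroup n F := by
  have hM : (M : Matrix n n F) = Matrix.diagonal fun i => M i i := by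
    ext i j
    by_cases hij : i = j
    · subst hij; simp
    · rw [Matrix.diagonal_apply_ne _ hij, h i j hij]
  have hne : ∀ i, M i i ≠ 0 := by
    have hdet : (M : Matrix n n F).det ≠ 0 := (Matrix.GeneralLinearGroup.det M).ne_zero
    rw [hM, Matrix.det_diagonal] at hdet
    exact fun i => Finset.prod_ne_zero_iff.1 hdet i (Finset.mem_univ i)
  refine ⟨MulEquiv.piUnits.symm fun i => Units.mk0 (M i i) (hne i), ?_⟩
  apply Units.ext
  exact hM.symm

/-- If the gauge transformation `P` over `K` brings `Y' = B Y` to diagonal form, then the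
differential Galois group is diagonal in a suitable basis of solutions. -/
theorem exists_fundamentalMatrix_range_le_diagonalGroup {B P : Matrix n n K} {a : n → K}
    (hdet : P.det ≠ 0)
    (hP : ∀ i j, Differential.deriv (P i j) + P i j * a j = ∑ k, B i k * P k j)
    (L : Type*) [Field L] [Differential L] [Algebra K L] (hL : IsPicardVessiot L B) :
    ∃ (U : Matrix.GeneralLinearGroup n L) (hU : IsFundamentalMatrix L B U),
      (galoisRep hL hU).range ≤ diagonalGroup n (constants K) := by
  obtain ⟨W, hW, -⟩ := hL.generated
  let Q : Matrix.GeneralLinearGroup n L := Matrix.GeneralLinearGroup.map (algebraMap K L)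
    (Matrix.GeneralLinearGroup.mkOfDetNeZero P hdet)
  have hQ : ∀ i j, Q i j = algebraMap K L (P i j) := fun i j => rfl
  have hQd : (Q : Matrix n n L).map Differential.deriv +
      Q * Matrix.diagonal (fun j => algebraMap K L (a j)) =
        B.map (algebraMap K L) * Q := by
    ext i j
    have := congrArg (algebraMap K L) (hP i j)
    rw [Matrix.add_apply, Matrix.mul_diagonal, Matrix.map_apply, hQ, hL.deriv_algebraMap]
    simpa [Matrix.mul_apply, hQ] using this
  set V : Matrix.GeneralLinearGroup n L := Q⁻¹ * W with hV
  have hQV : (Q : Matrix n n L) * (V : Matrix n n L) = W := by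
    rw [hV, ← Units.val_mul, mul_inv_cancel_left]
  have hVd : (V : Matrix n n L).map Differential.deriv =
      Matrix.diagonal (fun j => algebraMap K L (a j)) * V := by
    have h1 : (W : Matrix n n L).map Differential.deriv = B.map (algebraMap K L) * W := by
      ext i j
      simpa [Matrix.mul_apply] using hW i j
    have h2 : (W : Matrix n n L).map Differential.deriv =
        (Q : Matrix n n L).map Differential.deriv * V +
          Q * (V : Matrix n n L).map Differential.deriv := by
      ext i j
      rw [← hQV, Matrix.map_apply, deriv_matrix_mul]
    rw [h1, ← hQV, ← mul_assoc, ← hQd, add_mul, add_right_inj, mul_assoc] at h2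
    have := congrArg (fun M => ((Q⁻¹ : Matrix.GeneralLinearGroup n L) : Matrix n n L) * M) h2
    simpa only [← mul_assoc, ← Units.val_mul, inv_mul_cancel, Units.val_one, one_mul]
      using this.symm
  -- Row `j` of `V` consists of solutions in `L` of the scalar equation `y' = a_j y`. Since `V` is
  -- invertible, one of them is nonzero; it serves as `w_j`.
  have hrow : ∀ j, ∃ k, V j k ≠ 0 := by
    intro j
    by_contra! h
    exact (Matrix.GeneralLinearGroup.det V).ne_zero
      (Matrix.det_eq_zero_of_row_eq_zero j h)
  choose k hk using hrow
  set w : n → L := fun j => V j (k j) with hw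
  have hwd : ∀ j, Differential.deriv (w j) = algebraMap K L (a j) * w j := by
    intro j
    have := congrFun (congrFun hVd j) (k j)
    simpa [Matrix.diagonal_mul] using this
  let T : Matrix.GeneralLinearGroup n L := Matrix.GeneralLinearGroup.mkOfDetNeZero
    (Matrix.diagonal w) (by
      rw [Matrix.det_diagonal]
      exact Finset.prod_ne_zero_iff.2 fun j _ => hk j)
  have hQT : ∀ i j, (Q * T) i j = algebraMap K L (P i j) * w j := by
    intro i j
    change ((Q : Matrix n n L) * Matrix.diagonal w) i j = _
    rw [Matrix.mul_diagonal, hQ]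
  have hU : IsFundamentalMatrix L B (Q * T) := by
    intro i j
    have := congrArg (algebraMap K L) (hP i j)
    simp only [map_add, map_mul, map_sum] at this
    simp only [hQT, Derivation.leibniz, smul_eq_mul, hwd, hL.deriv_algebraMap, ← mul_assoc,
      ← Finset.sum_mul, ← this]
    ring
  refine ⟨Q * T, hU, ?_⟩
  rintro _ ⟨σ, rfl⟩
  apply mem_diagonalGroup
  intro i j hij
  -- `σ` fixes the entries of `P`, so it acts on column `j` through the factor `σ(w_j) / w_j` alone.
  have hdiag : (galoisMap (σ : L ≃ₐ[K] L) (Q * T) : Matrix n n L) =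
      ((Q * T : Matrix.GeneralLinearGroup n L) : Matrix n n L) *
        Matrix.diagonal fun j => (σ : L ≃ₐ[K] L) (w j) / w j := by
    ext i j
    have hj : w j ≠ 0 := hk j
    rw [Matrix.mul_diagonal, galoisMap_apply, hQT, map_mul, AlgEquiv.commutes]
    field_simp
  have h := congrArg (fun M : Matrix.GeneralLinearGroup n L => (M : Matrix n n L))
    (map_galoisMatrix hL hU σ)
  simp only [Units.val_mul] at h
  rw [hdiag, Units.val_mul, ← mul_assoc, ← Units.val_mul, ← Units.val_mul, inv_mul_cancel,
    Units.val_one, one_mul] at h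
  have hij' := congrFun (congrFun h i) j
  rw [Matrix.diagonal_apply_ne _ hij] at hij'
  exact constantsToExt_injective (L := L) (hij'.trans (map_zero _).symm)

end Gauge

/-! ### Derivatives and values of rational functions -/

section RationalFunctions

lemma deriv_ratFunc_algebraMap {F : Type*} [Field F] (p : Polynomial F) :
    Differential.deriv (algebraMap (Polynomial F) (RatFunc F) p) =
      algebraMap _ _ (Polynomial.derivative p) := by
  have := ratDeriv_div F p 1 one_ne_zero
  simpa [deriv_ratFunc] using this

lemma deriv_ratFunc_X {F : Type*} [Field F] :
    Differential.deriv (RatFunc.X : RatFunc F) = 1 := by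
  rw [← RatFunc.algebraMap_X, deriv_ratFunc_algebraMap, Polynomial.derivative_X, map_one]

lemma deriv_ratFunc_C {F : Type*} [Field F] (c : F) :
    Differential.deriv (RatFunc.C c : RatFunc F) = 0 := by
  rw [← RatFunc.algebraMap_C, deriv_ratFunc_algebraMap, Polynomial.derivative_C, map_zero]

/-- The rational function `f` has no pole at `t`, and its value there is `z`. -/
def HasValueAt {F : Type*} [Field F] (f : RatFunc F) (t z : F) : Prop :=
  f.denom.eval t ≠ 0 ∧ f.eval (RingHom.id F) t = z

variable {F : Type*} [Field F] {f g : RatFunc F} {t y z : F}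

lemma hasValueAt_C (c t : F) : HasValueAt (RatFunc.C c) t c := by
  simp [HasValueAt, RatFunc.denom_C]

lemma hasValueAt_zero (t : F) : HasValueAt (0 : RatFunc F) t 0 := by
  simpa using hasValueAt_C (0 : F) t

lemma hasValueAt_one (t : F) : HasValueAt (1 : RatFunc F) t 1 := by
  simpa using hasValueAt_C (1 : F) t

lemma hasValueAt_X (t : F) : HasValueAt (RatFunc.X : RatFunc F) t t := by
  simp [HasValueAt, RatFunc.denom_X]

lemma HasValueAt.mul (hf : HasValueAt f t y) (hg : HasValueAt g t z) :
    HasValueAt (f * g) t (y * z) := by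
  refine ⟨fun h => ?_, ?_⟩
  · have := Polynomial.eval_eq_zero_of_dvd_of_eval_eq_zero (RatFunc.denom_mul_dvd f g) h
    rw [Polynomial.eval_mul] at this
    exact mul_ne_zero hf.1 hg.1 this
  · rw [RatFunc.eval_mul (RingHom.id F) t hf.1 hg.1, hf.2, hg.2]

lemma HasValueAt.add (hf : HasValueAt f t y) (hg : HasValueAt g t z) :
    HasValueAt (f + g) t (y + z) := by
  refine ⟨fun h => ?_, ?_⟩
  · have := Polynomial.eval_eq_zero_of_dvd_of_eval_eq_zero (RatFunc.denom_add_dvd f g) h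
    rw [Polynomial.eval_mul] at this
    exact mul_ne_zero hf.1 hg.1 this
  · rw [RatFunc.eval_add (RingHom.id F) t hf.1 hg.1, hf.2, hg.2]

lemma HasValueAt.pow (hf : HasValueAt f t y) (n : ℕ) : HasValueAt (f ^ n) t (y ^ n) := by
  induction n with
  | zero => simpa using hasValueAt_one t
  | succ n ih => simpa only [pow_succ] using ih.mul hf

lemma hasValueAt_inv_X_sub_C {c : F} (h : t ≠ c) :
    HasValueAt (RatFunc.X - RatFunc.C c : RatFunc F)⁻¹ t (t - c)⁻¹ := by
  have hf : (RatFunc.X - RatFunc.C c : RatFunc F)⁻¹ =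
      algebraMap _ _ (1 : Polynomial F) / algebraMap _ _ (Polynomial.X - Polynomial.C c) := by
    simp
  have hne : (Polynomial.X - Polynomial.C c : Polynomial F) ≠ 0 := Polynomial.X_sub_C_ne_zero c
  have hden : (RatFunc.X - RatFunc.C c : RatFunc F)⁻¹.denom.eval t ≠ 0 := by
    intro h0
    rw [hf] at h0
    have := Polynomial.eval_eq_zero_of_dvd_of_eval_eq_zero (RatFunc.denom_div_dvd _ _) h0
    simp [sub_eq_zero, h] at this
  refine ⟨hden, ?_⟩
  have hX : HasValueAt (RatFunc.X - RatFunc.C c : RatFunc F) t (t - c) := by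
    simpa [sub_eq_add_neg] using (hasValueAt_X t).add (hasValueAt_C (-c) t)
  have h1 := RatFunc.eval_mul (RingHom.id F) t hX.1 hden
  have hne' : (RatFunc.X - RatFunc.C c : RatFunc F) ≠ 0 := by
    intro h0
    have := hX.2
    rw [h0, RatFunc.eval_zero] at this
    exact h (sub_eq_zero.1 this.symm)
  rw [mul_inv_cancel₀ hne', RatFunc.eval_one, hX.2] at h1
  exact eq_inv_of_mul_eq_one_right h1.symm

end RationalFunctions

/-! ### Diagonal gauges for second-order systems in dimension two -/

section NewtonMatrix

variable {K : Type*} [Field K]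

/-- The matrix of the first-order system equivalent to `ξ'' = S ξ`, `S` the symmetric matrix
with entries `x, y, z`. -/
def newtonMatrix (x y z : K) : Matrix (Fin 4) (Fin 4) K :=
  !![0, 0, 1, 0; 0, 0, 0, 1; x, y, 0, 0; y, z, 0, 0]

variable [Differential K]

/-- The equation `ξ'' = κ ξ` has two independent solutions with logarithmic derivative in `K`. -/
def HasRiccatiPair (κ : K) : Prop :=
  ∃ a b : K, a ≠ b ∧ Differential.deriv a + a ^ 2 = κ ∧ Differential.deriv b + b ^ 2 = κ

/-- `P` is a gauge transformation that brings `Y' = B Y` to diagonal form. -/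
def HasDiagonalGauge (B : Matrix (Fin 4) (Fin 4) K) : Prop :=
  ∃ (P : Matrix (Fin 4) (Fin 4) K) (a : Fin 4 → K), P.det ≠ 0 ∧
    ∀ i j, Differential.deriv (P i j) + P i j * a j = ∑ k, B i k * P k j

/-- The vectors `e`, `f` are constant eigenvectors of `S`, so `ξ = y e` is a solution when `y'' = κ₁
y`, and likewise for `f` and `κ₂`. A Riccati solution `a = y'/y` contributes the column `(e, a e)`
of `P` and the diagonal entry `a`. -/
lemma hasDiagonalGauge_of_riccati {x y z κ₁ κ₂ e₀ e₁ f₀ f₁ : K}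
    (h₁ : HasRiccatiPair κ₁) (h₂ : HasRiccatiPair κ₂)
    (he₀ : Differential.deriv e₀ = 0) (he₁ : Differential.deriv e₁ = 0)
    (hf₀ : Differential.deriv f₀ = 0) (hf₁ : Differential.deriv f₁ = 0)
    (hef : e₀ * f₁ - e₁ * f₀ ≠ 0)
    (hSe₀ : x * e₀ + y * e₁ = κ₁ * e₀) (hSe₁ : y * e₀ + z * e₁ = κ₁ * e₁)
    (hSf₀ : x * f₀ + y * f₁ = κ₂ * f₀) (hSf₁ : y * f₀ + z * f₁ = κ₂ * f₁) :
    HasDiagonalGauge (newtonMatrix x y z) := by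
  obtain ⟨a, b, hab, ha, hb⟩ := h₁
  obtain ⟨c, d, hcd, hc, hd⟩ := h₂
  refine ⟨!![e₀, e₀, f₀, f₀; e₁, e₁, f₁, f₁; a * e₀, b * e₀, c * f₀, d * f₀;
    a * e₁, b * e₁, c * f₁, d * f₁], ![a, b, c, d], ?_, ?_⟩
  · have : (!![e₀, e₀, f₀, f₀; e₁, e₁, f₁, f₁; a * e₀, b * e₀, c * f₀, d * f₀;
        a * e₁, b * e₁, c * f₁, d * f₁]).det =
        - (e₀ * f₁ - e₁ * f₀) ^ 2 * (a - b) * (c - d) := by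
      simp [Matrix.det_succ_row_zero, Fin.sum_univ_succ, Fin.succAbove]
      ring
    rw [this]
    exact mul_ne_zero (mul_ne_zero (neg_ne_zero.2 (pow_ne_zero 2 hef)) (sub_ne_zero.2 hab))
      (sub_ne_zero.2 hcd)
  · intro i j
    fin_cases i <;> fin_cases j <;>
      simp [newtonMatrix, Fin.sum_univ_four, he₀, he₁, hf₀, hf₁, Derivation.leibniz]
    · ring
    · ring
    · ring
    · ring
    · ring
    · ring
    · ring
    · ring
    · linear_combination e₀ * ha - hSe₀
    · linear_combination e₀ * hb - hSe₀
    · linear_combination f₀ * hc - hSf₀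
    · linear_combination f₀ * hd - hSf₀
    · linear_combination e₁ * ha - hSe₁
    · linear_combination e₁ * hb - hSe₁
    · linear_combination f₁ * hc - hSf₁
    · linear_combination f₁ * hd - hSf₁

/-- The system `ξ'' = β (v · ξ) v` with the isotropic vector `v = (1, μ)` is solved by
quadratures. -/
lemma hasDiagonalGauge_isotropic [CharZero K] {β μ T F F₁ G G₁ : K}
    (hμ : μ ^ 2 = -1) (hμ' : Differential.deriv μ = 0) (hT : Differential.deriv T = 1)
    (hF : Differential.deriv F = F₁) (hF₁ : Differential.deriv F₁ = β)
    (hG : Differential.deriv G = G₁) (hG₁ : Differential.deriv G₁ = β * T) :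
    HasDiagonalGauge (newtonMatrix β (μ * β) (-β)) := by
  have h1 : Differential.deriv (1 : K) = 0 := by simp
  have h2 : Differential.deriv (2 : K) = 0 := by
    rw [← one_add_one_eq_two, map_add, h1, add_zero]
  -- With `w = (1, -μ)`, `v · v = 0` and `v · w = 2`. The columns are the solutions `v`, `T v`, `w +
  -- 2 F v`, `T w + 2 G v` with their derivatives. They form a fundamental matrix over `K`, hence
  -- the zero diagonal part.
  refine ⟨!![1, T, 1 + 2 * F, T + 2 * G; μ, μ * T, -μ + 2 * F * μ, -(T * μ) + 2 * G * μ;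
    0, 1, 2 * F₁, 1 + 2 * G₁; 0, μ, 2 * F₁ * μ, -μ + 2 * G₁ * μ], 0, ?_, ?_⟩
  · have : (!![1, T, 1 + 2 * F, T + 2 * G; μ, μ * T, -μ + 2 * F * μ, -(T * μ) + 2 * G * μ;
        0, 1, 2 * F₁, 1 + 2 * G₁; 0, μ, 2 * F₁ * μ, -μ + 2 * G₁ * μ]).det = -4 * μ ^ 2 := by
      simp [Matrix.det_succ_row_zero, Fin.sum_univ_succ, Fin.succAbove]
      ring
    rw [this, hμ]
    norm_num
  · intro i j
    fin_cases i <;> fin_cases j <;>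
      simp [newtonMatrix, Fin.sum_univ_four, h2, hμ', hT, hF, hF₁, hG, hG₁, Derivation.leibniz]
    all_goals try ring1
    · linear_combination (-β) * hμ
    · linear_combination (-β * T) * hμ
    · linear_combination (β - 2 * β * F) * hμ
    · linear_combination (β * T - 2 * β * G) * hμ

end NewtonMatrix

/-! ### Scalar equations with constant and Euler coefficients -/

section Riccati

lemma hasRiccatiPair_const {κ : ℂ} (hκ : κ ≠ 0) : HasRiccatiPair (RatFunc.C κ) := by
  obtain ⟨r, hr⟩ := IsAlgClosed.exists_pow_nat_eq κ (n := 2) two_pos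
  have hr0 : r ≠ 0 := by rintro rfl; simp at hr; exact hκ hr.symm
  refine ⟨RatFunc.C r, RatFunc.C (-r), ?_, ?_, ?_⟩
  · intro h
    have := RatFunc.C_injective h
    exact hr0 (self_eq_neg.1 this)
  · rw [deriv_ratFunc_C, zero_add, ← map_pow, hr]
  · rw [deriv_ratFunc_C, zero_add, ← map_pow, neg_sq, hr]

/-- The Euler equation has the formal solutions `τ^ρ` and `τ^(1-ρ)`, whose logarithmic derivatives
lie in `K`; they differ because `2ρ ≠ 1`. -/
lemma hasRiccatiPair_of_deriv_eq_one {K : Type*} [Field K] [Differential K] {τ ρ : K}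
    (hτ : τ ≠ 0) (hτ' : Differential.deriv τ = 1) (hρ' : Differential.deriv ρ = 0)
    (hρ : 2 * ρ ≠ 1) : HasRiccatiPair (ρ * (ρ - 1) * τ⁻¹ ^ 2) := by
  have hτd : Differential.deriv τ⁻¹ = -τ⁻¹ ^ 2 := by
    rw [Derivation.leibniz_inv, hτ']
    simp
  have h1 : Differential.deriv (1 : K) = 0 := by simp
  refine ⟨ρ * τ⁻¹, (1 - ρ) * τ⁻¹, ?_, ?_, ?_⟩
  · intro h
    have := mul_right_cancel₀ (inv_ne_zero hτ) h
    exact hρ (by linear_combination this)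
  · rw [Derivation.leibniz, hρ', hτd]
    simp only [smul_eq_mul]
    ring
  · rw [Derivation.leibniz, map_sub, h1, hρ', hτd]
    simp only [smul_eq_mul]
    ring

lemma hasRiccatiPair_euler {ρ : ℂ} (hρ : 2 * ρ ≠ 1) (c : ℂ) :
    HasRiccatiPair (RatFunc.C (ρ * (ρ - 1)) * (RatFunc.X - RatFunc.C c)⁻¹ ^ 2) := by
  have hne : (RatFunc.X - RatFunc.C c : RatFunc ℂ) ≠ 0 := by
    rw [← RatFunc.algebraMap_X, ← RatFunc.algebraMap_C, ← map_sub]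
    exact RatFunc.algebraMap_ne_zero (Polynomial.X_sub_C_ne_zero c)
  have h := hasRiccatiPair_of_deriv_eq_one (ρ := RatFunc.C ρ) hne
    (by rw [map_sub, deriv_ratFunc_X, deriv_ratFunc_C, sub_zero]) (deriv_ratFunc_C ρ)
    (fun h => hρ (RatFunc.C_injective (by rw [map_mul, map_one, map_ofNat]; exact h)))
  simpa only [map_mul, map_sub, map_one] using h

end Riccati

/-! ### Zero-energy motion on a line -/

section Curves

variable {D : Set ℂ} {u p : ℂ → ℂ}

lemma exists_eq_const_of_hasDerivAt_zero (hD : IsOpen D) (hDc : IsConnected D)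
    (hu : ∀ t ∈ D, HasDerivAt u 0 t) : ∃ a, ∀ t ∈ D, u t = a := by
  refine hD.exists_is_const_of_fderiv_eq_zero (𝕜 := ℂ) hDc.isPreconnected
    (fun t ht => (hu t ht).differentiableAt.differentiableWithinAt) fun t ht => ?_
  ext
  simp [(hu t ht).deriv]

lemma exists_eq_affine_of_hasDerivAt (hD : IsOpen D) (hDc : IsConnected D) {b : ℂ}
    (hu : ∀ t ∈ D, HasDerivAt u b t) : ∃ a, ∀ t ∈ D, u t = a + b * t := by
  obtain ⟨a, ha⟩ := exists_eq_const_of_hasDerivAt_zero (u := fun t => u t - b * t) hD hDc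
    (fun t ht => ((hu t ht).sub ((hasDerivAt_id t).const_mul b)).congr_deriv (by simp))
  exact ⟨a, fun t ht => by linear_combination ha t ht⟩

/-- A solution of `u'² = C u²ˡ` that vanishes at one point of a domain vanishes identically. -/
lemma eq_zero_of_energy_of_eq_zero (hD : IsOpen D) (hDc : IsConnected D) {C : ℂ} (hC : C ≠ 0)
    {l : ℕ} (hl : 1 ≤ l) (hu : ∀ t ∈ D, HasDerivAt u (p t) t)
    (hE : ∀ t ∈ D, p t ^ 2 = C * u t ^ (2 * l)) {t₀ : ℂ} (ht₀ : t₀ ∈ D) (hz : u t₀ = 0) :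
    ∀ t ∈ D, u t = 0 := by
  have han : AnalyticOnNhd ℂ u D :=
    DifferentiableOn.analyticOnNhd
      (fun t ht => (hu t ht).differentiableAt.differentiableWithinAt) hD
  refine han.eqOn_zero_of_preconnected_of_eventuallyEq_zero hDc.isPreconnected ht₀ ?_
  change ∀ᶠ t in nhds t₀, u t = 0
  rw [← analyticOrderAt_eq_top]
  -- If `u` has a zero of finite order `n = m + 1`, then `u'` has order `m`, and the energy relation
  -- forces `2m = 2l(m + 1)`, impossible for `l ≥ 1`.
  by_contra htop
  have h0 := han t₀ ht₀
  have hord := h0.analyticOrderAt_deriv_add_one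
  simp only [hz, sub_zero] at hord
  have hEq : (deriv u) ^ 2 =ᶠ[nhds t₀] (fun _ => C) * u ^ (2 * l) := by
    filter_upwards [hD.mem_nhds ht₀] with t ht
    simp [(hu t ht).deriv, hE t ht]
  have h2 := analyticOrderAt_congr hEq
  rw [analyticOrderAt_pow h0.deriv, analyticOrderAt_mul analyticAt_const (h0.pow _),
    analyticOrderAt_pow h0, analyticAt_const.analyticOrderAt_eq_zero.2 hC, zero_add] at h2
  change analyticOrderAt u t₀ ≠ ⊤ at htop
  obtain ⟨n, hn⟩ := ENat.ne_top_iff_exists.1 htop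
  have hm : analyticOrderAt (deriv u) t₀ ≠ ⊤ := by
    intro h
    rw [h, top_add] at hord
    exact htop hord.symm
  obtain ⟨m, hm⟩ := ENat.ne_top_iff_exists.1 hm
  rw [← hn, ← hm] at hord h2
  have e1 : m + 1 = n := by exact_mod_cast hord
  have e2 : 2 * m = 2 * l * n := by
    simp only [nsmul_eq_mul] at h2
    exact_mod_cast h2
  subst e1
  nlinarith

/-- The solutions of `u'' = l C u²ˡ⁻¹` of zero energy `u'² = C u²ˡ`, with `l = m + 2`. -/
lemma eq_zero_or_pow_eq_of_energy (hD : IsOpen D) (hDc : IsConnected D) {C : ℂ} (hC : C ≠ 0)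
    {m : ℕ} (hu : ∀ t ∈ D, HasDerivAt u (p t) t)
    (hp : ∀ t ∈ D, HasDerivAt p ((m + 2) * C * u t ^ (2 * m + 3)) t)
    (hE : ∀ t ∈ D, p t ^ 2 = C * u t ^ (2 * (m + 2))) :
    (∀ t ∈ D, u t = 0) ∨ ∃ t₀, ∀ t ∈ D, t ≠ t₀ ∧
      (m + 1) ^ 2 * (C * u t ^ (2 * (m + 1))) = ((t - t₀)⁻¹) ^ 2 := by
  by_cases hz : ∃ t ∈ D, u t = 0
  · obtain ⟨t, ht, hz⟩ := hz
    exact Or.inl (eq_zero_of_energy_of_eq_zero hD hDc hC (by omega) hu hE ht hz)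
  right
  push Not at hz
  have hm : (m + 1 : ℂ) ≠ 0 := Nat.cast_add_one_ne_zero m
  -- This function is the derivative of `u^(-(m+1))`. The numerator of its own derivative is a
  -- multiple of `p² - C u^(2(m+2))`, which the energy relation kills.
  have hg : ∀ t ∈ D, HasDerivAt (fun t => -(m + 1) * p t / u t ^ (m + 2)) 0 t := by
    intro t ht
    have h := ((hp t ht).const_mul (-(m + 1 : ℂ))).div ((hu t ht).pow (m + 2))
      (pow_ne_zero _ (hz t ht))
    refine h.congr_deriv ?_
    rw [div_eq_zero_iff]
    left
    have hE' := hE t ht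
    simp only [Nat.cast_add, Nat.cast_ofNat, Pi.pow_apply, Nat.add_succ_sub_one]
    linear_combination (m + 1 : ℂ) * (m + 2) * u t ^ (m + 1) * hE'
  obtain ⟨g, hg⟩ := exists_eq_const_of_hasDerivAt_zero hD hDc hg
  have hf : ∀ t ∈ D, HasDerivAt (fun t => (u t ^ (m + 1))⁻¹) g t := by
    intro t ht
    have h := ((hu t ht).pow (m + 1)).inv (pow_ne_zero _ (hz t ht))
    refine h.congr_deriv ?_
    rw [← hg t ht]
    have := hz t ht
    simp only [Nat.cast_add, Nat.cast_one, Pi.pow_apply, Nat.add_succ_sub_one, add_zero]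
    field_simp
    ring
  obtain ⟨a, ha⟩ := exists_eq_affine_of_hasDerivAt hD hDc hf
  have hg2 : g ^ 2 = (m + 1) ^ 2 * C := by
    obtain ⟨t, ht⟩ := hDc.nonempty
    rw [← hg t ht, div_pow, mul_pow, hE t ht]
    have := hz t ht
    field_simp
    ring
  have hg0 : g ≠ 0 := by
    rintro rfl
    exact mul_ne_zero (pow_ne_zero 2 hm) hC (by rw [← hg2]; simp)
  -- The zero of the affine function `a + g t = u^(-(m+1))`. It lies outside `D`, where this
  -- function never vanishes.
  refine ⟨-a / g, fun t ht => ?_⟩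
  have hat : g * (t - -a / g) = (u t ^ (m + 1))⁻¹ := by
    rw [ha t ht]
    field_simp
    ring
  have hne : t - -a / g ≠ 0 := by
    intro h
    rw [h, mul_zero] at hat
    exact inv_ne_zero (pow_ne_zero _ (hz t ht)) hat.symm
  refine ⟨sub_ne_zero.1 hne, ?_⟩
  have hup : u t ^ (m + 1) = (g * (t - -a / g))⁻¹ := by rw [hat, inv_inv]
  rw [mul_comm 2 (m + 1), pow_mul, hup, ← mul_assoc, ← hg2]
  generalize t - -a / g = s at hne
  field_simp

end Curves

/-! ### The vector field and its linearization -/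

section Hamiltonian

open MvPolynomial

lemma eval_hamiltonian (α : ℂ) (l : ℕ) (z : Fin 4 → ℂ) :
    eval z (hamiltonian α l) = (z 2 ^ 2 + z 3 ^ 2) / 2 + α * (z 0 ^ 2 + z 1 ^ 2) ^ l := by
  simp [hamiltonian]
  ring

lemma hamiltonianField_hamiltonian (α : ℂ) (m : ℕ) :
    hamiltonianField (hamiltonian α (m + 1)) =
      ![X 2, X 3, C (-2 * (m + 1) * α) * X 0 * (X 0 ^ 2 + X 1 ^ 2) ^ m,
        C (-2 * (m + 1) * α) * X 1 * (X 0 ^ 2 + X 1 ^ 2) ^ m] := by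
  have h2 : (C 2⁻¹ : MvPolynomial (Fin 4) ℂ) * 2 = 1 := by
    rw [← map_ofNat C 2, ← map_mul]; simp
  have h2' : (C 2 : MvPolynomial (Fin 4) ℂ) = 2 := map_ofNat C 2
  ext1 i
  fin_cases i <;>
    simp [hamiltonianField, hamiltonian, pderiv_X, h2']
  · linear_combination X 2 * h2
  · linear_combination X 3 * h2
  · ring
  · ring

lemma variationalMatrix_one (α : ℂ) (z : Fin 4 → ℂ) :
    variationalMatrix (hamiltonian α 1) z = newtonMatrix (-2 * α) 0 (-2 * α) := by
  have := hamiltonianField_hamiltonian α 0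
  rw [zero_add] at this
  ext i j
  rw [variationalMatrix, this]
  fin_cases i <;> fin_cases j <;> simp [newtonMatrix, pderiv_X]

/-- Writing `l = m + 2` turns the exponents `l - 1` and `l - 2` of the Hessian into `m + 1` and `m`,
without truncated subtraction. -/
lemma variationalMatrix_add_two (α : ℂ) (m : ℕ) (z : Fin 4 → ℂ) :
    variationalMatrix (hamiltonian α (m + 2)) z = newtonMatrix
      (-2 * (m + 2) * α * ((z 0 ^ 2 + z 1 ^ 2) ^ (m + 1) +
        2 * (m + 1) * z 0 ^ 2 * (z 0 ^ 2 + z 1 ^ 2) ^ m))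
      (-2 * (m + 2) * α * (2 * (m + 1) * (z 0 * z 1) * (z 0 ^ 2 + z 1 ^ 2) ^ m))
      (-2 * (m + 2) * α * ((z 0 ^ 2 + z 1 ^ 2) ^ (m + 1) +
        2 * (m + 1) * z 1 ^ 2 * (z 0 ^ 2 + z 1 ^ 2) ^ m)) := by
  ext i j
  rw [variationalMatrix, hamiltonianField_hamiltonian α (m + 1)]
  fin_cases i <;> fin_cases j <;>
    simp [newtonMatrix, pderiv_X]
  all_goals ring

lemma isRationalOn_newtonMatrix {D : Set ℂ} {A : ℂ → Matrix (Fin 4) (Fin 4) ℂ}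
    {x y w : ℂ → ℂ} {x' y' w' : RatFunc ℂ} (hA : ∀ t ∈ D, A t = newtonMatrix (x t) (y t) (w t))
    (hx : ∀ t ∈ D, HasValueAt x' t (x t)) (hy : ∀ t ∈ D, HasValueAt y' t (y t))
    (hw : ∀ t ∈ D, HasValueAt w' t (w t)) :
    IsRationalOn D A (newtonMatrix x' y' w') := by
  intro t ht i j
  rw [hA t ht]
  change HasValueAt _ _ _
  fin_cases i <;> fin_cases j <;>
    simp [newtonMatrix, hasValueAt_zero, hasValueAt_one, hx t ht, hy t ht, hw t ht]

end Hamiltonian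

lemma exists_polynomial_derivative_eq {F : Type*} [Field F] [CharZero F] (p : Polynomial F) :
    ∃ q : Polynomial F, Polynomial.derivative q = p := by
  induction p using Polynomial.induction_on' with
  | add p q hp hq =>
    obtain ⟨P, rfl⟩ := hp
    obtain ⟨Q, rfl⟩ := hq
    exact ⟨P + Q, Polynomial.derivative_add⟩
  | monomial n a =>
    refine ⟨Polynomial.monomial (n + 1) (a / (n + 1)), ?_⟩
    rw [Polynomial.derivative_monomial]
    have : (n + 1 : F) ≠ 0 := Nat.cast_add_one_ne_zero n
    simp [this]

/-- Antiderivatives of polynomials are polynomials, so the quadratures never leave `ℂ[t]`. -/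
lemma hasDiagonalGauge_isotropic_polynomial {μ : ℂ} (hμ : μ ^ 2 = -1) (p : Polynomial ℂ) :
    HasDiagonalGauge (newtonMatrix (algebraMap _ (RatFunc ℂ) p)
      (RatFunc.C μ * algebraMap _ (RatFunc ℂ) p) (-algebraMap _ (RatFunc ℂ) p)) := by
  obtain ⟨F₁, hF₁⟩ := exists_polynomial_derivative_eq p
  obtain ⟨F, hF⟩ := exists_polynomial_derivative_eq F₁
  obtain ⟨G₁, hG₁⟩ := exists_polynomial_derivative_eq (p * Polynomial.X)
  obtain ⟨G, hG⟩ := exists_polynomial_derivative_eq G₁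
  have : CharZero (RatFunc ℂ) := charZero_of_injective_algebraMap (RatFunc.C_injective (K := ℂ))
  refine hasDiagonalGauge_isotropic (by rw [← map_pow, hμ, map_neg, map_one])
    (deriv_ratFunc_C μ) deriv_ratFunc_X (F := algebraMap _ _ F) (F₁ := algebraMap _ _ F₁)
    (G := algebraMap _ _ G) (G₁ := algebraMap _ _ G₁) ?_ ?_ ?_ ?_
  · rw [deriv_ratFunc_algebraMap, hF]
  · rw [deriv_ratFunc_algebraMap, hF₁]
  · rw [deriv_ratFunc_algebraMap, hG]
  · rw [deriv_ratFunc_algebraMap, hG₁, map_mul, RatFunc.algebraMap_X]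

/-! ### Diagonal gauges for the three cases -/

section Planes

variable {α : ℂ} {a b : ℂ} {D : Set ℂ} {γ : ℂ → Fin 4 → ℂ}

lemma IsIntegralCurve.hasDerivAt_hamiltonian {m : ℕ}
    (hγ : IsIntegralCurve (hamiltonian α (m + 1)) D γ) {t : ℂ} (ht : t ∈ D) :
    HasDerivAt (fun s => γ s 0) (γ t 2) t ∧ HasDerivAt (fun s => γ s 1) (γ t 3) t ∧
    HasDerivAt (fun s => γ s 2)
      (-2 * (m + 1) * α * γ t 0 * (γ t 0 ^ 2 + γ t 1 ^ 2) ^ m) t ∧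
    HasDerivAt (fun s => γ s 3)
      (-2 * (m + 1) * α * γ t 1 * (γ t 0 ^ 2 + γ t 1 ^ 2) ^ m) t := by
  have h := hγ t ht
  rw [hamiltonianField_hamiltonian] at h
  exact ⟨by simpa using h 0, by simpa using h 1, by simpa using h 2, by simpa using h 3⟩

lemma exists_rational_gauge_linear (hα : α ≠ 0) :
    ∃ B : Matrix (Fin 4) (Fin 4) (RatFunc ℂ),
      IsRationalOn D (fun t => variationalMatrix (hamiltonian α 1) (γ t)) B ∧
      HasDiagonalGauge B := by
  have hκ := hasRiccatiPair_const (mul_ne_zero (neg_ne_zero.2 two_ne_zero) hα)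
  refine ⟨newtonMatrix (RatFunc.C (-2 * α)) 0 (RatFunc.C (-2 * α)),
    isRationalOn_newtonMatrix (fun t _ => variationalMatrix_one α (γ t))
      (fun t _ => hasValueAt_C _ t) (fun t _ => hasValueAt_zero t) (fun t _ => hasValueAt_C _ t),
    hasDiagonalGauge_of_riccati (e₀ := 1) (e₁ := 0) (f₀ := 0) (f₁ := 1) hκ hκ ?_ ?_ ?_ ?_ ?_
      ?_ ?_ ?_ ?_⟩ <;> simp

lemma exists_rational_gauge_isotropic {m : ℕ} (hD : IsOpen D) (hDc : IsConnected D)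
    (hγ : IsIntegralCurve (hamiltonian α (m + 2)) D γ)
    (hplane : ∀ t ∈ D, γ t ∈ invariantPlane a b) (hab : a ≠ 0 ∨ b ≠ 0) (hs : a ^ 2 + b ^ 2 = 0) :
    ∃ B : Matrix (Fin 4) (Fin 4) (RatFunc ℂ),
      IsRationalOn D (fun t => variationalMatrix (hamiltonian α (m + 2)) (γ t)) B ∧
      HasDiagonalGauge B := by
  have hb : b ≠ 0 := by
    rintro rfl
    simp at hs
    simp [hs] at hab
  -- The line `a q₁ + b q₂ = 0` is spanned by the isotropic vector `(1, μ)`.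
  obtain ⟨μ, hμab⟩ : ∃ μ, a = -μ * b := ⟨-a / b, by field_simp⟩
  have hμ : μ ^ 2 = -1 := by
    have : b ^ 2 * (μ ^ 2 + 1) = 0 := by rw [← hs, hμab]; ring
    have := (mul_eq_zero.1 this).resolve_left (pow_ne_zero 2 hb)
    linear_combination this
  have hq : ∀ t ∈ D, γ t 1 = μ * γ t 0 := by
    intro t ht
    have h := (hplane t ht).1
    rw [hμab] at h
    apply mul_left_cancel₀ hb
    linear_combination h
  have hR : ∀ t ∈ D, γ t 0 ^ 2 + γ t 1 ^ 2 = 0 := by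
    intro t ht
    rw [hq t ht]
    linear_combination γ t 0 ^ 2 * hμ
  -- The force has a factor `R^(m+1) = 0`, so `p₁` is constant and `q₁` is affine in `t`.
  obtain ⟨c, hc⟩ := exists_eq_const_of_hasDerivAt_zero (u := fun s => γ s 2) hD hDc
    (fun t ht => (hγ.hasDerivAt_hamiltonian ht).2.2.1.congr_deriv (by simp [hR t ht]))
  obtain ⟨d, hd⟩ := exists_eq_affine_of_hasDerivAt (u := fun s => γ s 0) hD hDc
    (fun t ht => (hγ.hasDerivAt_hamiltonian ht).1.congr_deriv (hc t ht))
  -- The factor `0 ^ m` is the value of `R^m`: it is `1` for `m = 0`, that is `l = 2`, and `0`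
  -- otherwise. Both cases are thus treated at once.
  set k : ℂ := -4 * (m + 2) * (m + 1) * α * 0 ^ m with hk
  set p : Polynomial ℂ :=
    Polynomial.C k * (Polynomial.C d + Polynomial.C c * Polynomial.X) ^ 2 with hp
  have hval : ∀ t ∈ D, HasValueAt (algebraMap _ (RatFunc ℂ) p) t (k * γ t 0 ^ 2) := by
    intro t ht
    simp only [hp, map_mul, map_pow, map_add, RatFunc.algebraMap_C, RatFunc.algebraMap_X]
    rw [hd t ht]
    exact (hasValueAt_C k t).mul
      (((hasValueAt_C d t).add ((hasValueAt_C c t).mul (hasValueAt_X t))).pow 2)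
  refine ⟨_, isRationalOn_newtonMatrix
    (fun t ht => (variationalMatrix_add_two α m (γ t)).trans ?_) hval
    (fun t ht => (hasValueAt_C μ t).mul (hval t ht))
    (w := fun t => -1 * (k * γ t 0 ^ 2)) (fun t ht => ?_),
    hasDiagonalGauge_isotropic_polynomial hμ p⟩
  · rw [hR t ht, hq t ht, zero_pow (Nat.succ_ne_zero m)]
    congr 1
    · rw [hk]; ring
    · rw [hk]; ring
    · rw [hk]
      linear_combination (-2 * (m + 2) * α * 2 * (m + 1) * γ t 0 ^ 2 * 0 ^ m) * hμ
  · simpa using (hasValueAt_C (-1) t).mul (hval t ht)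

lemma exists_rational_gauge_nonisotropic {m : ℕ} (hα : α ≠ 0) (hD : IsOpen D)
    (hDc : IsConnected D) (hγ : IsIntegralCurve (hamiltonian α (m + 2)) D γ)
    (hplane : ∀ t ∈ D, γ t ∈ invariantPlane a b)
    (hzero : ∀ t ∈ D, MvPolynomial.eval (γ t) (hamiltonian α (m + 2)) = 0)
    (hs : a ^ 2 + b ^ 2 ≠ 0) :
    ∃ B : Matrix (Fin 4) (Fin 4) (RatFunc ℂ),
      IsRationalOn D (fun t => variationalMatrix (hamiltonian α (m + 2)) (γ t)) B ∧
      HasDiagonalGauge B := by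
  set s : ℂ := a ^ 2 + b ^ 2 with hs'
  -- `u` and `p` are the coordinates of position and momentum along `(-b, a)`, which spans the line
  -- `a q₁ + b q₂ = 0`.
  set u : ℂ → ℂ := fun t => (a * γ t 1 - b * γ t 0) / s with hu
  set p : ℂ → ℂ := fun t => (a * γ t 3 - b * γ t 2) / s with hp
  have hq0 : ∀ t ∈ D, γ t 0 = -b * u t := by
    intro t ht
    simp only [hu]
    field_simp
    linear_combination a * (hplane t ht).1 + γ t 0 * hs'
  have hq1 : ∀ t ∈ D, γ t 1 = a * u t := by
    intro t ht
    simp only [hu]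
    field_simp
    linear_combination b * (hplane t ht).1 + γ t 1 * hs'
  have hp0 : ∀ t ∈ D, γ t 2 = -b * p t := by
    intro t ht
    simp only [hp]
    field_simp
    linear_combination a * (hplane t ht).2 + γ t 2 * hs'
  have hp1 : ∀ t ∈ D, γ t 3 = a * p t := by
    intro t ht
    simp only [hp]
    field_simp
    linear_combination b * (hplane t ht).2 + γ t 3 * hs'
  have hR : ∀ t ∈ D, γ t 0 ^ 2 + γ t 1 ^ 2 = s * u t ^ 2 := by
    intro t ht
    rw [hq0 t ht, hq1 t ht, hs']
    ring
  set C : ℂ := -2 * α * s ^ (m + 1) with hCdef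
  have hC : C ≠ 0 := mul_ne_zero (mul_ne_zero (neg_ne_zero.2 two_ne_zero) hα) (pow_ne_zero _ hs)
  have hup : ∀ t ∈ D, HasDerivAt u (p t) t := by
    intro t ht
    obtain ⟨h0, h1, -, -⟩ := hγ.hasDerivAt_hamiltonian ht
    exact ((h1.const_mul a).sub (h0.const_mul b)).div_const s
  have hpp : ∀ t ∈ D, HasDerivAt p ((m + 2) * C * u t ^ (2 * m + 3)) t := by
    intro t ht
    obtain ⟨-, -, h2, h3⟩ := hγ.hasDerivAt_hamiltonian ht
    refine (((h3.const_mul a).sub (h2.const_mul b)).div_const s).congr_deriv ?_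
    rw [hR t ht, hq0 t ht, hq1 t ht, div_eq_iff hs, hCdef]
    push_cast
    rw [mul_pow, ← pow_mul]
    linear_combination (2 * (m + 2) * α * s ^ (m + 1) * u t ^ (2 * m + 3)) * hs'
  have hE : ∀ t ∈ D, p t ^ 2 = C * u t ^ (2 * (m + 2)) := by
    intro t ht
    have h := hzero t ht
    rw [eval_hamiltonian, hR t ht, hp0 t ht, hp1 t ht, mul_pow s, ← pow_mul] at h
    apply mul_left_cancel₀ hs
    rw [hCdef]
    linear_combination 2 * h + p t ^ 2 * hs'
  have hm : (m + 1 : ℂ) ≠ 0 := Nat.cast_add_one_ne_zero m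
  -- `κ` is the eigenvalue of `S` on the normal direction `(a, b)`. On the tangent direction `(-b,
  -- a)` the eigenvalue is `(2l - 1) κ = (2m + 3) κ`.
  obtain ⟨κ, hκ, hκ₁, hκ₂⟩ : ∃ κ : RatFunc ℂ,
      (∀ t ∈ D, HasValueAt κ t ((m + 2) * (C * u t ^ (2 * (m + 1))))) ∧
      HasRiccatiPair κ ∧ HasRiccatiPair (RatFunc.C (2 * m + 3 : ℂ) * κ) := by
    rcases eq_zero_or_pow_eq_of_energy hD hDc hC hup hpp hE with h | ⟨t₀, h⟩
    · have hr : HasRiccatiPair (0 : RatFunc ℂ) := by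
        simpa using hasRiccatiPair_euler (ρ := 0) (by simp) 0
      refine ⟨0, fun t ht => ?_, hr, by simpa using hr⟩
      simpa [h t ht] using hasValueAt_zero t
    · refine ⟨RatFunc.C ((m + 2) / (m + 1) ^ 2 : ℂ) * (RatFunc.X - RatFunc.C t₀)⁻¹ ^ 2,
        fun t ht => ?_, ?_, ?_⟩
      · obtain ⟨hne, hpow⟩ := h t ht
        have := (hasValueAt_C ((m + 2) / (m + 1) ^ 2 : ℂ) t).mul
          ((hasValueAt_inv_X_sub_C hne).pow 2)
        rw [← hpow] at this
        convert this using 1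
        field_simp
      -- Here `ρ - 1 = 1 / (m + 1)`, so `ρ (ρ - 1) = (m + 2) / (m + 1)²`. An equality `2ρ = 1` would
      -- give `m + 3 = 0`.
      · have := hasRiccatiPair_euler (ρ := (m + 2) / (m + 1)) (by
          rw [mul_div_assoc', Ne, div_eq_one_iff_eq hm]
          intro h
          have h' : (m + 3 : ℂ) = 0 := by linear_combination h
          exact Nat.cast_add_one_ne_zero (R := ℂ) (m + 2) (by push_cast; linear_combination h')) t₀
        convert this using 3
        field_simp
        ring
      -- Here `ρ - 1 = (m + 2) / (m + 1)`, so `ρ (ρ - 1)` is `2m + 3` times the previous constant.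
      · have := hasRiccatiPair_euler (ρ := (2 * m + 3) / (m + 1)) (by
          rw [mul_div_assoc', Ne, div_eq_one_iff_eq hm]
          intro h
          have h' : (3 * m + 5 : ℂ) = 0 := by linear_combination h
          exact Nat.cast_add_one_ne_zero (R := ℂ) (3 * m + 4)
            (by push_cast; linear_combination h')) t₀
        rw [← mul_assoc, ← map_mul]
        convert this using 3
        field_simp
        ring
  have hX : ∀ t ∈ D, ∀ c : ℂ, HasValueAt (RatFunc.C c * κ) t
      (c * ((m + 2) * (C * u t ^ (2 * (m + 1))))) := fun t ht c => (hasValueAt_C c t).mul (hκ t ht)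
  -- With `f = (-b, a)` and `f · f = s`, the three entries are those of `S = κ (1 + 2(m + 1) f fᵀ /
  -- s)`.
  refine ⟨_, isRationalOn_newtonMatrix
    (fun t ht => (variationalMatrix_add_two α m (γ t)).trans ?_)
    (fun t ht => hX t ht (1 + 2 * (m + 1) * b ^ 2 / s))
    (fun t ht => hX t ht (-2 * (m + 1) * (a * b) / s))
    (fun t ht => hX t ht (1 + 2 * (m + 1) * a ^ 2 / s)),
    hasDiagonalGauge_of_riccati hκ₁ hκ₂ (deriv_ratFunc_C a) (deriv_ratFunc_C b)
      (deriv_ratFunc_C (-b)) (deriv_ratFunc_C a) ?_ ?_ ?_ ?_ ?_⟩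
  · rw [hR t ht, hq0 t ht, hq1 t ht, hCdef]
    congr 1 <;>
    · field_simp
      ring_nf
  · rw [← map_mul, ← map_mul, ← map_sub]
    intro h
    rw [← map_zero RatFunc.C] at h
    exact hs (by linear_combination hs' + RatFunc.C_injective h)
  · rw [mul_right_comm, mul_right_comm (RatFunc.C _) κ, ← map_mul, ← map_mul, ← add_mul,
      ← map_add, mul_comm κ]
    congr 2
    field_simp
    ring
  · rw [mul_right_comm, mul_right_comm (RatFunc.C _) κ, ← map_mul, ← map_mul, ← add_mul,
      ← map_add, mul_comm κ]
    congr 2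
    field_simp
    ring
  · rw [mul_right_comm, mul_right_comm (RatFunc.C _) κ, mul_right_comm (RatFunc.C _) κ,
      ← map_mul, ← map_mul, ← map_mul, ← add_mul, ← map_add]
    congr 2
    field_simp
    linear_combination (-b * (2 * m + 2)) * hs'
  · rw [mul_right_comm, mul_right_comm (RatFunc.C _) κ, mul_right_comm (RatFunc.C _) κ,
      ← map_mul, ← map_mul, ← map_mul, ← add_mul, ← map_add]
    congr 2
    field_simp
    linear_combination (a * (2 * m + 2)) * hs'

end Planes

end VariationalGalois

end

/-! ### The theorem -/

open VariationalGalois in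
theorem proposition3 (α : ℂ) (hα : α ≠ 0) (l : ℕ) (hl : 1 ≤ l)
    (lam₁ lam₂ : ℂ) (hlam : lam₁ ≠ 0 ∨ lam₂ ≠ 0)
    (D : Set ℂ) (hD : IsOpen D) (hDc : IsConnected D) (γ : ℂ → Fin 4 → ℂ)
    (hγ : IsIntegralCurve (hamiltonian α l) D γ)
    (hplane : ∀ t ∈ D, γ t ∈ invariantPlane lam₁ lam₂)
    (hzero : ∀ t ∈ D, MvPolynomial.eval (γ t) (hamiltonian α l) = 0) :
    ∃ B : Matrix (Fin 4) (Fin 4) (RatFunc ℂ),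
      IsRationalOn D (fun t => variationalMatrix (hamiltonian α l) (γ t)) B ∧
      ∀ (L : Type*) [Field L] [Differential L] [Algebra (RatFunc ℂ) L]
        (hL : IsPicardVessiot L B),
        ∃ (U : Matrix.GeneralLinearGroup (Fin 4) L) (hU : IsFundamentalMatrix L B U),
          (identityComponent (galoisRep hL hU)).map (galoisRep hL hU) ≤
            diagonalGroup (Fin 4) (constants (RatFunc ℂ)) := by
  obtain ⟨B, hB, P, w, hdet, hP⟩ : ∃ B : Matrix (Fin 4) (Fin 4) (RatFunc ℂ),
      IsRationalOn D (fun t => variationalMatrix (hamiltonian α l) (γ t)) B ∧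
      HasDiagonalGauge B := by
    obtain rfl | ⟨m, rfl⟩ : l = 1 ∨ ∃ m, l = m + 2 := by
      rcases hl.eq_or_lt with h | h
      · exact Or.inl h.symm
      · exact Or.inr ⟨l - 2, by omega⟩
    · exact exists_rational_gauge_linear hα
    · by_cases hs : lam₁ ^ 2 + lam₂ ^ 2 = 0
      · exact exists_rational_gauge_isotropic hD hDc hγ hplane hlam hs
      · exact exists_rational_gauge_nonisotropic hα hD hDc hγ hplane hzero hs
  refine ⟨B, hB, fun L _ _ _ hL => ?_⟩
  obtain ⟨U, hU, h⟩ := exists_fundamentalMatrix_range_le_diagonalGroup hdet hP L hL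
  -- The image of the identity component lies in the image of the whole group, which is already
  -- diagonal.
  refine ⟨U, hU, le_trans ?_ h⟩
  rintro _ ⟨σ, -, rfl⟩
  exact ⟨σ, rfl⟩
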